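/- **Conventions.** An $[[n,k]]$ stabilizer code $\mathcal{Q}$ is given by an abelian group $\mathcal{S}$ of $n$-qubit Pauli operators with $n-k$ independent generators and $-I\notin\mathcal{S}$; its code space is the joint $+1$ eigenspace of $\mathcal{S}$. It is a *self-dual CSS code* if, for some matrix $A\in\mathbb{Z}_2^{r\times n}$ with $2r=n-k$, $\mathcal{S}$ is generated by the $X$-type and the $Z$-type Pauli operators given by the rows of $A$. A *symplectic basis* of $\mathcal{Q}$ consists of Hermitian Pauli operators $\bar X_j,\bar Z_j$ ($1\le j\le k$) commuting with $\mathcal{S}$ such that $\bar X_j,\bar Z_j$ anticommute, all other pairs of these operators commute, and these operators together with $\mathcal{S}$ and $iI$ generate the centralizer of $\mathcal{S}$ in the Pauli group. It defines the $k$ logical qubits of $\mathcal{Q}$: a gate on the logical qubits acts on the code space by substituting $\bar X_j,\bar Z_j$ for $X_j,Z_j$; the logical gates obtained in this way from $H_j$, $S_j$ are denoted $\bar H_j$, $\bar S_j$. Equality of gates means equality on the code space up to a global phase. A symplectic basis is *compatible* if $\bigotimes_{j=1}^k\bar H_j=\bigotimes_{i=1}^n H_i$ and for every $a\in\{\pm1\}^k$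 there is $b\in\{\pm1\}^n$ with $\bigotimes_{j=1}^k\bar S_j^{a_j}=\bigotimes_{i=1}^n S_i^{b_i}$, where $H$ is the Hadamard gate and $S=\mathrm{diag}(1,i)$. Given $[[n_l,k_l]]$ stabilizer codes $\mathcal{Q}_l$ with symplectic bases ($1\le l\le L$), the *concatenated code* $\mathcal{Q}_L\circ\cdots\circ\mathcal{Q}_1$ has physical qubits (level $0$) labelled by $[n_1]\times\cdots\times[n_L]$ and logical qubits at level $l$ labelled by $[k_1]\times\cdots\times[k_l]\times[n_{l+1}]\times\cdots\times[n_L]$; there are $N^{(l)}=\prod_{i\le l}k_i\prod_{i>l}n_i$ of them, and $N=N^{(0)}$, $K=N^{(L)}$. For all $(j_1,\dots,j_{l-1},i_{l+1},\dots,i_L)$, the code $\mathcal{Q}_l$ encodes the $k_l$ logical qubits $(j_1,\dots,j_{l-1},\cdot,i_{l+1},\dots,i_L)$ at level $l$ into the $n_l$ logical qubits $(j_1,\dots,j_{l-1},\cdot,i_{l+1},\dots,i_L)$ at level $l-1$. $G^{(l)}_q$ denotes the single-qubit gate $G$ on the logical qubit $q$ at level $l$. A gate is *transversal at level $m$* if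 it equals $\bigotimes_{q=1}^{N^{(m)}}G^{(m)}_q$ for some single-qubit (unitary) gates $G_q$ acting on the logical qubits at level $m$. **Corollary.** Let $\mathcal{Q}_1,\dots,\mathcal{Q}_L$ be self-dual CSS codes with $k_l\ge1$, the logical Pauli operators of each being defined by a compatible symplectic basis, and consider the concatenated code $\mathcal{Q}_L\circ\cdots\circ\mathcal{Q}_1$. Then: 1. $\bigotimes_{j=1}^{K}H^{(L)}_j$ is transversal at levels $0,\dots,L$ and equals $\bigotimes_{i=1}^{N}H^{(0)}_i$. 2. For every $a\in\{\pm1\}^K$, $\bigotimes_{j=1}^{K}\bigl(S^{(L)}_j\bigr)^{a_j}$ is transversal at levels $0,\dots,L$ and equals $\bigotimes_{i=1}^{N}\bigl(S^{(0)}_i\bigr)^{b_i}$ for some $b\in\{\pm1\}^N$. -/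

import Mathlib

open scoped Matrix

noncomputable section

namespace QCode

/-! ### Qubits, gates, Pauli operators -/

/-- States (not necessarily normalized) of qubits labelled by `ι`, in the computational basis. -/
abbrev State (ι : Type) : Type := (ι → Fin 2) → ℂ

/-- Linear operators on the state space of qubits labelled by `ι`. -/
abbrev Op (ι : Type) : Type := Matrix (ι → Fin 2) (ι → Fin 2) ℂ

/-- The tensor product `⨂ i, G i` of single-qubit operators. -/
def tensor {ι : Type} [Fintype ι] (G : ι → Matrix (Fin 2) (Fin 2) ℂ) : Op ι :=
  Matrix.of fun x y => ∏ i, G i (x i) (y i)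

def pauliX : Matrix (Fin 2) (Fin 2) ℂ := !![0, 1; 1, 0]

def pauliZ : Matrix (Fin 2) (Fin 2) ℂ := !![1, 0; 0, -1]

/-- The Hadamard gate `H`. -/
def hadamard : Matrix (Fin 2) (Fin 2) ℂ := ((Real.sqrt 2 : ℝ) : ℂ)⁻¹ • !![1, 1; 1, -1]

/-- The phase gate `S`. -/
def phase : Matrix (Fin 2) (Fin 2) ℂ := !![1, 0; 0, Complex.I]

/-- The `X`-type Pauli operator with binary vector `u`. -/
def xOp {ι : Type} [Fintype ι] (u : ι → ZMod 2) : Op ι :=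
  tensor fun i => if u i = 1 then pauliX else 1

/-- The `Z`-type Pauli operator with binary vector `u`. -/
def zOp {ι : Type} [Fintype ι] (u : ι → ZMod 2) : Op ι :=
  tensor fun i => if u i = 1 then pauliZ else 1

/-- Membership in the Pauli group (phases `±1, ±i`). -/
def IsPauli {ι : Type} [Fintype ι] [DecidableEq ι] (P : Op ι) : Prop :=
  ∃ (t : ℕ) (u v : ι → ZMod 2), P = Complex.I ^ t • (xOp u * zOp v)

/-- `U` and `V` agree, up to a global phase, on the subspace `W`. -/
def EqOn {ι : Type} [Fintype ι] [DecidableEq ι] (W : Submodule ℂ (State ι)) (U V : Op ι) : Prop :=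
  ∃ c : ℂ, ‖c‖ = 1 ∧ ∀ ψ ∈ W, U *ᵥ ψ = c • (V *ᵥ ψ)

/-- The simultaneous `+1` eigenspace of a set of operators. -/
def fixedSpace {ι : Type} [Fintype ι] [DecidableEq ι] (T : Set (Op ι)) : Submodule ℂ (State ι) where
  carrier := {ψ | ∀ g ∈ T, g *ᵥ ψ = ψ}
  add_mem' := by
    intro a b ha hb g hg
    rw [Matrix.mulVec_add, ha g hg, hb g hg]
  zero_mem' := by
    intro g _
    exact Matrix.mulVec_zero g
  smul_mem' := by
    intro c a ha g hg
    rw [Matrix.mulVec_smul, ha g hg]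

/-! ### Stabilizer codes and symplectic bases -/

/-- A stabilizer code encoding `k` logical qubits into `n` physical qubits, given by its stabilizer
group: an abelian group of Pauli operators without `-1`, with `n - k` independent generators. -/
structure StabilizerCode (n k : ℕ) where
  stab : Subgroup (Matrix.unitaryGroup (Fin n → Fin 2) ℂ)
  isPauli : ∀ g ∈ stab, IsPauli (g : Op (Fin n))
  comm : ∀ g ∈ stab, ∀ h ∈ stab, g * h = h * g
  neg_one_notMem : ∀ g ∈ stab, (g : Op (Fin n)) ≠ -1
  le : k ≤ n
  card : Nat.card stab = 2 ^ (n - k)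

/-- The set of stabilizers, as operators. -/
def StabilizerCode.ops {n k : ℕ} (Q : StabilizerCode n k) : Set (Op (Fin n)) :=
  {g | ∃ s ∈ Q.stab, (s : Op (Fin n)) = g}

def StabilizerCode.codeSpace {n k : ℕ} (Q : StabilizerCode n k) : Submodule ℂ (State (Fin n)) :=
  fixedSpace Q.ops

/-- The code is a CSS code whose two check matrices coincide (`H_x = H_z`, with `r = (n - k) / 2`
rows). -/
def StabilizerCode.IsSelfDualCSS {n k : ℕ} (Q : StabilizerCode n k) : Prop :=
  ∃ r : ℕ, n = k + 2 * r ∧ ∃ A : Matrix (Fin r) (Fin n) (ZMod 2),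
    Q.stab = Subgroup.closure
      {g : Matrix.unitaryGroup (Fin n → Fin 2) ℂ | ∃ i, (g : Op (Fin n)) = xOp (A i) ∨
        (g : Op (Fin n)) = zOp (A i)}

/-- A symplectic basis: `k` hyperbolic pairs of Hermitian Pauli operators `(X j, Z j)` in the
centralizer of the stabilizer group which, together with the stabilizers and `i`, generate the
centralizer (in the Pauli group). These are the logical Pauli operators. -/
structure SymplecticBasis {n k : ℕ} (Q : StabilizerCode n k) where
  X : Fin k → Matrix.unitaryGroup (Fin n → Fin 2) ℂ
  Z : Fin k → Matrix.unitaryGroup (Fin n → Fin 2) ℂ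
  isPauli_X : ∀ j, IsPauli (X j : Op (Fin n))
  isPauli_Z : ∀ j, IsPauli (Z j : Op (Fin n))
  X_sq : ∀ j, X j * X j = 1
  Z_sq : ∀ j, Z j * Z j = 1
  X_stab : ∀ j, ∀ g ∈ Q.stab, X j * g = g * X j
  Z_stab : ∀ j, ∀ g ∈ Q.stab, Z j * g = g * Z j
  anticomm : ∀ j,
    (X j : Op (Fin n)) * (Z j : Op (Fin n)) = -((Z j : Op (Fin n)) * (X j : Op (Fin n)))
  X_Z : ∀ j j', j ≠ j' → X j * Z j' = Z j' * X j
  X_X : ∀ j j', X j * X j' = X j' * X j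
  Z_Z : ∀ j j', Z j * Z j' = Z j' * Z j
  generate : ∀ P : Matrix.unitaryGroup (Fin n → Fin 2) ℂ, IsPauli (P : Op (Fin n)) →
    (∀ g ∈ Q.stab, P * g = g * P) →
    P ∈ Subgroup.closure ((Q.stab : Set (Matrix.unitaryGroup (Fin n → Fin 2) ℂ)) ∪
      Set.range X ∪ Set.range Z ∪ {g | (g : Op (Fin n)) = Complex.I • (1 : Op (Fin n))})

namespace SymplecticBasis

variable {n k : ℕ} {Q : StabilizerCode n k}

/-- The logical operator `∏ j, X_j ^ (x j)`. -/
def xPow (B : SymplecticBasis Q) (x : Fin k → Fin 2) : Op (Fin n) :=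
  (List.ofFn fun j => (B.X j : Op (Fin n)) ^ (x j : ℕ)).prod

/-- The projector `∏ j, (1 + Z_j) / 2` on the common `+1` eigenspace of the logical `Z` operators;
on the code space it is the projector on the logical state `|0…0⟩`. -/
def zeroProj (B : SymplecticBasis Q) : Op (Fin n) :=
  (List.ofFn fun j => (2 : ℂ)⁻¹ • (1 + (B.Z j : Op (Fin n)))).prod

/-- The logical gate `U` on the `k` logical qubits, as an operator on the physical qubits. The
logical basis states are `|x⟩ = (∏ j, X_j ^ (x j)) |0…0⟩`, and on the code space this operator is
`∑ x y, U x y |x⟩⟨y|`. The formula is the substitution of the logical Pauli operators `X j`, `Z j`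
for the Pauli operators on qubit `j` in `U`. -/
def logical (B : SymplecticBasis Q) (U : Op (Fin k)) : Op (Fin n) :=
  ∑ x, ∑ y, U x y • (B.xPow x * B.zeroProj * (B.xPow y)ᴴ)

/-- The symplectic basis is compatible with multilevel transversal Clifford operations. -/
structure IsCompatible (B : SymplecticBasis Q) : Prop where
  hadamard : EqOn Q.codeSpace
    (B.logical (tensor fun _ => QCode.hadamard)) (tensor fun _ => QCode.hadamard)
  phase : ∀ a : Fin k → ℤˣ, ∃ b : Fin n → ℤˣ, EqOn Q.codeSpace
    (B.logical (tensor fun j => QCode.phase ^ ((a j : ℤˣ) : ℤ)))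
    (tensor fun i => QCode.phase ^ ((b i : ℤˣ) : ℤ))

end SymplecticBasis

/-- A stabilizer code together with the symplectic basis that defines its logical qubits. -/
structure BasedCode where
  n : ℕ
  k : ℕ
  code : StabilizerCode n k
  basis : SymplecticBasis code

/-! ### Tensor powers of operator maps -/

/-- For a linear map `Φ` of operators, the map `⨂ r, Φ`, applied to the block of qubits `(·, r)`
for each `r`. -/
def onCols {A B R : Type} [Fintype A] [DecidableEq A] [Fintype R] [DecidableEq R]
    (Φ : Op A → Op B) (U : Op (A × R)) : Op (B × R) :=
  Matrix.of fun x y => ∑ a, ∑ b, U a b *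
    ∏ r, Φ (Matrix.single (fun i => a (i, r)) (fun i => b (i, r)) 1)
      (fun i => x (i, r)) (fun i => y (i, r))

/-- For a linear map `Φ` of operators, the map `⨂ r, Φ`, applied to the block of qubits `(r, ·)`
for each `r`. -/
def onRows {A B R : Type} [Fintype A] [DecidableEq A] [Fintype R] [DecidableEq R]
    (Φ : Op A → Op B) (U : Op (R × A)) : Op (R × B) :=
  Matrix.of fun x y => ∑ a, ∑ b, U a b *
    ∏ r, Φ (Matrix.single (fun i => a (r, i)) (fun i => b (r, i)) 1)
      (fun i => x (r, i)) (fun i => y (r, i))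

/-- The operator `g` on the block of qubits `(·, r)`, the identity on all other qubits. -/
def atCol {A R : Type} [Fintype A] [Fintype R] [DecidableEq R] (r : R) (g : Op A) : Op (A × R) :=
  Matrix.of fun x y =>
    if ∀ i r', r' ≠ r → x (i, r') = y (i, r') then g (fun i => x (i, r)) (fun i => y (i, r)) else 0

/-- The operator `g` on the block of qubits `(r, ·)`, the identity on all other qubits. -/
def atRow {A R : Type} [Fintype A] [Fintype R] [DecidableEq R] (r : R) (g : Op A) : Op (R × A) :=
  Matrix.of fun x y =>
    if ∀ i r', r' ≠ r → x (r', i) = y (r', i) then g (fun i => x (r, i)) (fun i => y (r, i)) else 0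

/-! ### Concatenated codes

The innermost code `Q_1` is `C 0`, the outermost code `Q_L` is `C (L - 1)`. -/

/-- Labels of the logical qubits at level `l`:
`[k_1] × ⋯ × [k_l] × [n_{l+1}] × ⋯ × [n_L]` (with a one-point factor at the end). -/
def Qubit : {L : ℕ} → (Fin L → BasedCode) → ℕ → Type
  | 0, _, _ => Unit
  | _ + 1, C, 0 => Fin (C 0).n × Qubit (fun i => C i.succ) 0
  | _ + 1, C, l + 1 => Fin (C 0).k × Qubit (fun i => C i.succ) l

instance Qubit.instFintype : {L : ℕ} → (C : Fin L → BasedCode) → (l : ℕ) → Fintype (Qubit C l)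
  | 0, _, _ => inferInstanceAs (Fintype Unit)
  | _ + 1, C, 0 =>
    letI := Qubit.instFintype (fun i => C i.succ) 0
    inferInstanceAs (Fintype (Fin (C 0).n × Qubit (fun i => C i.succ) 0))
  | _ + 1, C, l + 1 =>
    letI := Qubit.instFintype (fun i => C i.succ) l
    inferInstanceAs (Fintype (Fin (C 0).k × Qubit (fun i => C i.succ) l))

instance Qubit.instDecidableEq :
    {L : ℕ} → (C : Fin L → BasedCode) → (l : ℕ) → DecidableEq (Qubit C l)
  | 0, _, _ => inferInstanceAs (DecidableEq Unit)
  | _ + 1, C, 0 =>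
    letI := Qubit.instDecidableEq (fun i => C i.succ) 0
    inferInstanceAs (DecidableEq (Fin (C 0).n × Qubit (fun i => C i.succ) 0))
  | _ + 1, C, l + 1 =>
    letI := Qubit.instDecidableEq (fun i => C i.succ) l
    inferInstanceAs (DecidableEq (Fin (C 0).k × Qubit (fun i => C i.succ) l))

/-- A gate on the logical qubits at level `l`, as an operator on the physical qubits (level `0`).
The codes `Q_2, …, Q_L` are used on `k_1` copies of their qubits, labelled by `j_1 ∈ [k_1]`, and
`Q_1` encodes one block of `n_1` physical qubits for each `(i_2, …, i_L)`. -/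
def lift : {L : ℕ} → (C : Fin L → BasedCode) → (l : ℕ) → Op (Qubit C l) → Op (Qubit C 0)
  | 0, _, _ => fun U => U
  | _ + 1, _, 0 => fun U => U
  | _ + 1, C, l + 1 => fun U =>
    onCols (R := Qubit (fun i => C i.succ) 0) (C 0).basis.logical
      (onRows (R := Fin (C 0).k) (lift (fun i => C i.succ) l) U)

/-- Stabilizer generators of the concatenated code `Q_L ∘ ⋯ ∘ Q_1`: the stabilizers of `Q_1` on
each of its blocks, and the stabilizer generators of `Q_L ∘ ⋯ ∘ Q_2` on each of its `k_1` copies,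
with logical operators of `Q_1` substituted. -/
def stabGens : {L : ℕ} → (C : Fin L → BasedCode) → Set (Op (Qubit C 0))
  | 0, _ => ∅
  | _ + 1, C =>
    {M | ∃ r : Qubit (fun i => C i.succ) 0, ∃ g ∈ (C 0).code.ops, M = atCol r g} ∪
    {M | ∃ j : Fin (C 0).k, ∃ g ∈ stabGens (fun i => C i.succ),
      M = onCols (R := Qubit (fun i => C i.succ) 0) (C 0).basis.logical (atRow j g)}

/-- The code space of the concatenated code. -/
def codeSpace {L : ℕ} (C : Fin L → BasedCode) : Submodule ℂ (State (Qubit C 0)) :=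
  fixedSpace (stabGens C)

/-- The gate `U` on the logical qubits at level `l` equals (is implemented by) the gate `V` on the
logical qubits at level `m`: they agree on the code space up to a global phase. -/
def GateEq {L : ℕ} (C : Fin L → BasedCode) {l m : ℕ} (U : Op (Qubit C l)) (V : Op (Qubit C m)) :
    Prop :=
  EqOn (codeSpace C) (lift C l U) (lift C m V)

/-- The gate `U` on the logical qubits at level `l` is transversal at level `m`: it is a tensor
product of single-qubit gates on the logical qubits at level `m`. -/
def IsTransversalAt {L : ℕ} (C : Fin L → BasedCode) {l : ℕ} (U : Op (Qubit C l)) (m : ℕ) : Prop :=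
  ∃ G : Qubit C m → Matrix.unitaryGroup (Fin 2) ℂ,
    GateEq C U (tensor fun i => (G i : Matrix (Fin 2) (Fin 2) ℂ))

end QCode

end

/-!
Let `Ψ` be a homomorphism, not necessarily unital, between the algebras of operators on two systems
of qubits. Contracting a state fixed by `Ψ(T)` with the operators `Ψ |i⟩⟨j|` gives states fixed by
`T`, so an equality `U = V` on the space fixed by `T` implies `Ψ U = Ψ V` on the space fixed by
`Ψ(T)`, with the same global phase. Placing an operator on one block of qubits, the logical
substitution of a code, and tensor powers of homomorphisms are homomorphisms of this kind. Hence a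
family of single-qubit gates whose tensor products each code of the concatenation implements by
tensor products from the same family can be pushed down through the levels, block by block.
-/

namespace QCode

section EqOn

variable {ι κ : Type} [Fintype ι] [DecidableEq ι] [Fintype κ] [DecidableEq κ]

lemma fixedSpace_anti {S T : Set (Op ι)} (h : S ⊆ T) : fixedSpace T ≤ fixedSpace S :=
  fun _ hψ g hg => hψ g (h hg)

lemma EqOn.refl (W : Submodule ℂ (State ι)) (U : Op ι) : EqOn W U U :=
  ⟨1, norm_one, fun _ _ => (one_smul ℂ _).symm⟩

lemma EqOn.trans {W : Submodule ℂ (State ι)} {U V M : Op ι} (h₁ : EqOn W U V) (h₂ : EqOn W V M) :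
    EqOn W U M := by
  obtain ⟨c, hc, hUV⟩ := h₁
  obtain ⟨d, hd, hVM⟩ := h₂
  exact ⟨c * d, by rw [norm_mul, hc, hd, one_mul], fun ψ hψ => by
    rw [hUV ψ hψ, hVM ψ hψ, smul_smul]⟩

lemma EqOn.mono {W W' : Submodule ℂ (State ι)} {U V : Op ι} (h : EqOn W U V) (hW : W' ≤ W) :
    EqOn W' U V := by
  obtain ⟨c, hc, hUV⟩ := h
  exact ⟨c, hc, fun ψ hψ => hUV ψ (hW hψ)⟩

lemma EqOn.mul_left {W : Submodule ℂ (State ι)} {U V : Op ι} (M : Op ι) (h : EqOn W U V) :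
    EqOn W (M * U) (M * V) := by
  obtain ⟨c, hc, hUV⟩ := h
  exact ⟨c, hc, fun ψ hψ => by
    rw [← Matrix.mulVec_mulVec, hUV ψ hψ, Matrix.mulVec_smul, Matrix.mulVec_mulVec]⟩

/-- The state of the qubits `ι` with coefficients `j ↦ ⟨x| Ψ(|i⟩⟨j|) |φ⟩`. If `Ψ U = U ⊗ 1`, these
are the slices of the tensor `φ`; a state is recovered from its slices up to `Ψ 1`. -/
def slice (Ψ : Op ι →ₙₐ[ℂ] Op κ) (φ : State κ) (i : ι → Fin 2) (x : κ → Fin 2) : State ι :=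
  fun j => (Ψ (Matrix.single i j 1) *ᵥ φ) x

lemma mulVec_slice (Ψ : Op ι →ₙₐ[ℂ] Op κ) (U : Op ι) (φ : State κ) (i : ι → Fin 2)
    (x : κ → Fin 2) : U *ᵥ slice Ψ φ i x = slice Ψ (Ψ U *ᵥ φ) i x := by
  ext j
  have hU : Matrix.single i j 1 * U = ∑ l, U j l • Matrix.single i l (1 : ℂ) := by
    ext a b
    by_cases ha : a = i
    · simp [ha, Matrix.sum_apply, Matrix.single_apply]
    · simp [Matrix.single_mul_apply_of_ne _ _ _ _ _ ha, Matrix.sum_apply, Ne.symm ha]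
  simp only [slice, Matrix.mulVec_mulVec, ← map_mul, hU, map_sum, map_smul, Matrix.sum_mulVec,
    Matrix.smul_mulVec, Finset.sum_apply, Pi.smul_apply, smul_eq_mul]
  rfl

lemma slice_mem_fixedSpace {Ψ : Op ι →ₙₐ[ℂ] Op κ} {T : Set (Op ι)} {φ : State κ}
    (hφ : φ ∈ fixedSpace (Ψ '' T)) (i : ι → Fin 2) (x : κ → Fin 2) :
    slice Ψ φ i x ∈ fixedSpace T := fun g hg => by
  rw [mulVec_slice, hφ _ (Set.mem_image_of_mem Ψ hg)]

lemma map_one_mulVec_apply (Ψ : Op ι →ₙₐ[ℂ] Op κ) (φ : State κ) (x : κ → Fin 2) :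
    (Ψ 1 *ᵥ φ) x = ∑ i, slice Ψ φ i x i := by
  rw [← Matrix.sum_single_one, map_sum, Matrix.sum_mulVec, Finset.sum_apply]
  rfl

theorem EqOn.map (Ψ : Op ι →ₙₐ[ℂ] Op κ) {T : Set (Op ι)} {U V : Op ι}
    (h : EqOn (fixedSpace T) U V) : EqOn (fixedSpace (Ψ '' T)) (Ψ U) (Ψ V) := by
  obtain ⟨c, hc, hUV⟩ := h
  refine ⟨c, hc, fun φ hφ => funext fun x => ?_⟩
  have expand (M : Op ι) : (Ψ M *ᵥ φ) x = ∑ i, (M *ᵥ slice Ψ φ i x) i := by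
    simp only [mulVec_slice, ← map_one_mulVec_apply, Matrix.mulVec_mulVec, ← map_mul, one_mul]
  rw [Pi.smul_apply, expand, expand, Finset.smul_sum]
  exact Finset.sum_congr rfl fun i _ => congrFun (hUV _ (slice_mem_fixedSpace hφ i x)) i

end EqOn

section MatrixUnits

variable {m R S : Type*} [Fintype m] [DecidableEq m] [CommSemiring R] [NonUnitalSemiring S]
  [Module R S] [IsScalarTower R S S] [SMulCommClass R S S]

/-- The homomorphism `∑ a b, U a b |a⟩⟨b| ↦ ∑ a b, U a b E a b` defined by a system of matrix
units `E`. It is unital only if `∑ a, E a a = 1`. -/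
def ofMatrixUnits (E : m → m → S)
    (hE : ∀ a b c d, E a b * E c d = if b = c then E a d else 0) : Matrix m m R →ₙₐ[R] S where
  toFun U := ∑ a, ∑ b, U a b • E a b
  map_smul' c U := by simp [Finset.smul_sum, smul_smul]
  map_zero' := by simp
  map_add' U V := by simp [add_smul, Finset.sum_add_distrib]
  map_mul' U V := by
    rw [Finset.sum_mul]
    refine Finset.sum_congr rfl fun a _ => ?_
    calc ∑ d, (U * V) a d • E a d
        = ∑ b, ∑ d, (U a b * V b d) • E a d := by
          simp only [Matrix.mul_apply, Finset.sum_smul]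
          exact Finset.sum_comm
      _ = (∑ b, U a b • E a b) * ∑ c, ∑ d, V c d • E c d := by
          simp only [Finset.sum_mul, Finset.mul_sum, smul_mul_smul_comm, hE, smul_ite, smul_zero]
          refine Finset.sum_congr rfl fun b _ => ?_
          rw [Finset.sum_comm]
          simp

lemma ofMatrixUnits_apply (E : m → m → S)
    (hE : ∀ a b c d, E a b * E c d = if b = c then E a d else 0) (U : Matrix m m R) :
    ofMatrixUnits E hE U = ∑ a, ∑ b, U a b • E a b := rfl

end MatrixUnits

section Blocks

variable {R A B I J : Type}

/-- Configurations of the qubits `I` as families of configurations of the blocks `e (r, ·)`. -/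
def blockEquiv (e : R × A ≃ I) : (I → Fin 2) ≃ (R → A → Fin 2) :=
  (e.arrowCongr (Equiv.refl (Fin 2))).symm.trans (Equiv.curry R A (Fin 2))

variable [Fintype R]

/-- The tensor product of the operators `M r` acting on the blocks `e (r, ·)` of the qubits `I`. -/
def blockTensor (e : R × A ≃ I) (M : R → Op A) : Op I :=
  Matrix.of fun x y => ∏ r, M r (blockEquiv e x r) (blockEquiv e y r)

lemma tensor_eq_blockTensor [Fintype A] [Fintype I] (e : R × A ≃ I)
    (G : I → Matrix (Fin 2) (Fin 2) ℂ) :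
    tensor G = blockTensor e fun r => tensor fun i => G (e (r, i)) := by
  ext x y
  exact (Equiv.prod_comp e fun i => G i (x i) (y i)).symm.trans (Fintype.prod_prod_type _)

variable [Fintype A]

/-- The operator `g` on the block `e (r, ·)` of the qubits `I`, the identity on all others. -/
def atBlock [DecidableEq R] (e : R × A ≃ I) (r : R) (g : Op A) : Op I :=
  Matrix.of fun x y =>
    if ∀ i r', r' ≠ r → x (e (r', i)) = y (e (r', i)) then
      g (fun i => x (e (r, i))) (fun i => y (e (r, i)))
    else 0

lemma atBlock_eq_blockTensor [DecidableEq R] (e : R × A ≃ I) (r : R) (g : Op A) :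
    atBlock e r g = blockTensor e (Function.update 1 r g) := by
  ext x y
  have hrest : ∏ s ∈ Finset.univ.erase r, (Function.update (1 : R → Op A) r g s)
      (blockEquiv e x s) (blockEquiv e y s) =
      if ∀ i r', r' ≠ r → x (e (r', i)) = y (e (r', i)) then 1 else 0 := by
    have hone : ∀ s ∈ Finset.univ.erase r, Function.update (1 : R → Op A) r g s
        (blockEquiv e x s) (blockEquiv e y s) =
        if blockEquiv e x s = blockEquiv e y s then 1 else 0 := fun s hs => by
      rw [Function.update_of_ne (Finset.ne_of_mem_erase hs), Pi.one_apply, Matrix.one_apply]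
    rw [Finset.prod_congr rfl hone, Finset.prod_ite_zero, Finset.prod_const_one]
    simp only [Finset.mem_erase, Finset.mem_univ, and_true, funext_iff]
    exact if_congr ⟨fun h i s hs => h s hs i, fun h s hs i => h i s hs⟩ rfl rfl
  rw [blockTensor, Matrix.of_apply, ← Finset.mul_prod_erase _ _ (Finset.mem_univ r), hrest,
    Function.update_self, mul_ite, mul_one, mul_zero]
  rfl

variable [DecidableEq A] [Fintype I] [DecidableEq I]

lemma sum_prod_blockEquiv (e : R × A ≃ I) (f : R → (A → Fin 2) → ℂ) :
    ∑ z, ∏ r, f r (blockEquiv e z r) = ∏ r, ∑ w, f r w := by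
  classical
  rw [Finset.prod_univ_sum, Fintype.piFinset_univ]
  exact (blockEquiv e).sum_comp fun z => ∏ r, f r (z r)

lemma blockTensor_mul (e : R × A ≃ I) (M N : R → Op A) :
    blockTensor e (M * N) = blockTensor e M * blockTensor e N := by
  ext x y
  simp only [blockTensor, Matrix.mul_apply, Matrix.of_apply, Pi.mul_apply,
    ← Finset.prod_mul_distrib]
  exact (sum_prod_blockEquiv e fun r w =>
    M r (blockEquiv e x r) w * N r w (blockEquiv e y r)).symm

variable [Fintype B] [DecidableEq B] [Fintype J] [DecidableEq J]

omit [DecidableEq I] in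
lemma blockTensor_map_single_mul (e : R × A ≃ I) (f : R × B ≃ J) (Φ : Op A →ₙₐ[ℂ] Op B)
    (a b c d : I → Fin 2) :
    (blockTensor f fun r => Φ (Matrix.single (blockEquiv e a r) (blockEquiv e b r) 1)) *
        (blockTensor f fun r => Φ (Matrix.single (blockEquiv e c r) (blockEquiv e d r) 1)) =
      if b = c then
        blockTensor f fun r => Φ (Matrix.single (blockEquiv e a r) (blockEquiv e d r) 1)
      else 0 := by
  rw [← blockTensor_mul]
  split_ifs with h
  · subst h
    congr 1 with r : 1
    rw [Pi.mul_apply, ← map_mul, Matrix.single_mul_single_same, one_mul]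
  · obtain ⟨r, hr⟩ := Function.ne_iff.1 ((blockEquiv e).injective.ne h)
    ext x y
    refine Finset.prod_eq_zero (Finset.mem_univ r) ?_
    rw [Pi.mul_apply, ← map_mul, Matrix.single_mul_single_of_ne (h := hr), map_zero,
      Matrix.zero_apply]

/-- The tensor power `⨂ r, Φ` of a homomorphism `Φ`, mapping operators on the blocks `e (r, ·)` to
operators on the blocks `f (r, ·)`. -/
def onBlocks (e : R × A ≃ I) (f : R × B ≃ J) (Φ : Op A →ₙₐ[ℂ] Op B) : Op I →ₙₐ[ℂ] Op J :=
  ofMatrixUnits _ (blockTensor_map_single_mul e f Φ)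

lemma onBlocks_apply (e : R × A ≃ I) (f : R × B ≃ J) (Φ : Op A →ₙₐ[ℂ] Op B) (U : Op I)
    (x y : J → Fin 2) :
    onBlocks e f Φ U x y = ∑ a, ∑ b, U a b *
      ∏ r, Φ (Matrix.single (blockEquiv e a r) (blockEquiv e b r) 1)
        (blockEquiv f x r) (blockEquiv f y r) := by
  rw [onBlocks, ofMatrixUnits_apply]
  simp only [Matrix.sum_apply, Matrix.smul_apply, smul_eq_mul]
  rfl

lemma onBlocks_blockTensor (e : R × A ≃ I) (f : R × B ≃ J) (Φ : Op A →ₙₐ[ℂ] Op B)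
    (M : R → Op A) : onBlocks e f Φ (blockTensor e M) = blockTensor f fun r => Φ (M r) := by
  ext x y
  have expand (N : Op A) (u v : B → Fin 2) :
      Φ N u v = ∑ a, ∑ b, N a b * Φ (Matrix.single a b 1) u v := by
    conv_lhs => rw [Matrix.matrix_eq_sum_single N]
    simp only [map_sum, Matrix.sum_apply, ← smul_eq_mul, ← Matrix.smul_apply, ← map_smul,
      Matrix.smul_single]
    simp only [smul_eq_mul, mul_one]
  simp only [onBlocks_apply, blockTensor, Matrix.of_apply, expand (M _), ← sum_prod_blockEquiv e,
    ← Finset.prod_mul_distrib]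

variable [DecidableEq R]

lemma onCols_eq_onBlocks (Φ : Op A →ₙₐ[ℂ] Op B) :
    onCols (R := R) Φ = onBlocks (Equiv.prodComm R A) (Equiv.prodComm R B) Φ := by
  ext U x y
  rw [onBlocks_apply]
  rfl

lemma onRows_eq_onBlocks (Φ : Op A →ₙₐ[ℂ] Op B) :
    onRows (R := R) Φ = onBlocks (Equiv.refl (R × A)) (Equiv.refl (R × B)) Φ := by
  ext U x y
  rw [onBlocks_apply]
  rfl

/-- `atBlock` as a homomorphism of algebras. -/
def atBlockHom (e : R × A ≃ I) (r : R) : Op A →ₙₐ[ℂ] Op I where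
  toFun := atBlock e r
  map_smul' c g := by ext x y; simp [atBlock]
  map_zero' := by ext x y; simp [atBlock]
  map_add' g h := by ext x y; simp [atBlock, ← ite_add_zero]
  map_mul' g h := by
    simp only [atBlock_eq_blockTensor, ← blockTensor_mul, ← Function.update_mul, one_mul]

lemma blockTensor_update (e : R × A ≃ I) (M : R → Op A) (r : R) (g : Op A) :
    blockTensor e (Function.update M r g) =
      blockTensor e (Function.update M r 1) * atBlockHom e r g := by
  change _ = _ * atBlock e r g
  rw [atBlock_eq_blockTensor, ← blockTensor_mul, ← Function.update_mul, mul_one, one_mul]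

/-- The factors `U r` are replaced by `V r` one block at a time. -/
theorem eqOn_blockTensor (e : R × A ≃ I) {T : R → Set (Op A)} {U V : R → Op A}
    (h : ∀ r, EqOn (fixedSpace (T r)) (U r) (V r)) :
    EqOn (fixedSpace (⋃ r, atBlockHom e r '' T r)) (blockTensor e U) (blockTensor e V) := by
  suffices key : ∀ s : Finset R, EqOn (fixedSpace (⋃ r, atBlockHom e r '' T r))
      (blockTensor e (s.piecewise U V)) (blockTensor e V) by
    simpa using key Finset.univ
  intro s
  induction s using Finset.induction_on with
  | empty => simpa using EqOn.refl _ _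
  | insert r s hr ih =>
    refine EqOn.trans ?_ ih
    have hV : s.piecewise U V = Function.update (s.piecewise U V) r (V r) := by
      rw [← Finset.piecewise_eq_of_notMem s U V hr, Function.update_eq_self]
    rw [Finset.piecewise_insert, hV, Function.update_idem, blockTensor_update,
      blockTensor_update e _ r (V r)]
    exact (((h r).map (atBlockHom e r)).mono
      (fixedSpace_anti (Set.subset_iUnion_of_subset r subset_rfl))).mul_left _

end Blocks

section ListProd

variable {R M : Type*}

lemma mul_list_prod_of_mem [Monoid M] {z p : M} {l : List M} (hp : p ∈ l) (hzp : z * p = p)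
    (hcomm : ∀ q ∈ l, Commute z q) : z * l.prod = l.prod := by
  obtain ⟨s, t, rfl⟩ := List.append_of_mem hp
  have hs : Commute z s.prod :=
    Commute.list_prod_right _ _ fun q hq => hcomm q (List.mem_append_left _ hq)
  rw [List.prod_append, List.prod_cons, ← mul_assoc, hs.eq, mul_assoc, ← mul_assoc z, hzp]

lemma mul_list_prod_eq_self [Monoid M] {a : M} {l : List M} (h : ∀ q ∈ l, a * q = a) :
    a * l.prod = a := by
  induction l with
  | nil => exact mul_one a
  | cons q l ih =>
    rw [List.prod_cons, ← mul_assoc, h q List.mem_cons_self,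
      ih fun p hp => h p (List.mem_cons_of_mem q hp)]

lemma mul_prod_ofFn_eq_smul [CommSemiring R] [Semiring M] [Algebra R M] {k : ℕ} {z : M}
    {f : Fin k → M} {c : Fin k → R} (h : ∀ i, z * f i = c i • (f i * z)) :
    z * (List.ofFn f).prod = (∏ i, c i) • ((List.ofFn f).prod * z) := by
  induction k with
  | zero => simp
  | succ k ih =>
    rw [List.ofFn_succ, List.prod_cons, Fin.prod_univ_succ, ← mul_assoc, h 0, smul_mul_assoc,
      mul_assoc, ih fun i => h i.succ, mul_smul_comm, smul_smul, mul_assoc]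

end ListProd

namespace SymplecticBasis

variable {n k : ℕ} {Q : StabilizerCode n k} (B : SymplecticBasis Q)

lemma Z_mul_self (j : Fin k) : (B.Z j : Op (Fin n)) * B.Z j = 1 :=
  congrArg Subtype.val (B.Z_sq j)

lemma commute_Z_Z (j j' : Fin k) : Commute (B.Z j : Op (Fin n)) (B.Z j') :=
  congrArg Subtype.val (B.Z_Z j j')

lemma Z_mul_X (j i : Fin k) :
    (B.Z j : Op (Fin n)) * B.X i =
      (if i = j then (-1 : ℂ) else 1) • ((B.X i : Op (Fin n)) * B.Z j) := by
  split_ifs with h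
  · rw [h, B.anticomm, neg_one_smul, neg_neg]
  · rw [one_smul]
    exact (congrArg Subtype.val (B.X_Z i j h)).symm

lemma Z_mul_xPow (j : Fin k) (x : Fin k → Fin 2) :
    (B.Z j : Op (Fin n)) * B.xPow x = (-1 : ℂ) ^ (x j : ℕ) • (B.xPow x * B.Z j) := by
  have hX (i : Fin k) : (B.Z j : Op (Fin n)) * (B.X i : Op (Fin n)) ^ (x i : ℕ) =
      (if i = j then (-1 : ℂ) ^ (x i : ℕ) else 1) •
        ((B.X i : Op (Fin n)) ^ (x i : ℕ) * B.Z j) := by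
    rcases Fin.exists_fin_two.1 ⟨x i, rfl⟩ with h | h
    · simp [h]
    · simpa [h] using B.Z_mul_X j i
  simpa [xPow] using mul_prod_ofFn_eq_smul hX

lemma xPow_mem_unitaryGroup (x : Fin k → Fin 2) :
    B.xPow x ∈ Matrix.unitaryGroup (Fin n → Fin 2) ℂ :=
  list_prod_mem <| List.forall_mem_ofFn_iff.2 fun j => pow_mem (B.X j).2 _

lemma xPow_conjTranspose_mul_self (x : Fin k → Fin 2) : (B.xPow x)ᴴ * B.xPow x = 1 :=
  Matrix.mem_unitaryGroup_iff'.1 (B.xPow_mem_unitaryGroup x)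

lemma xPow_conjTranspose_mul_Z (j : Fin k) (x : Fin k → Fin 2) :
    (B.xPow x)ᴴ * (B.Z j : Op (Fin n)) = (-1 : ℂ) ^ (x j : ℕ) • (B.Z j * (B.xPow x)ᴴ) := by
  have hZ : (B.Z j : Op (Fin n))ᴴ = B.Z j :=
    congrArg Subtype.val (inv_eq_of_mul_eq_one_left (B.Z_sq j))
  simpa [hZ] using congrArg Matrix.conjTranspose (B.Z_mul_xPow j x)

lemma commute_Z_smul_one_add_Z (j j' : Fin k) :
    Commute (B.Z j : Op (Fin n)) ((2 : ℂ)⁻¹ • (1 + (B.Z j' : Op (Fin n)))) :=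
  ((Commute.one_right _).add_right (B.commute_Z_Z j j')).smul_right _

lemma Z_mul_zeroProj (j : Fin k) : (B.Z j : Op (Fin n)) * B.zeroProj = B.zeroProj := by
  refine mul_list_prod_of_mem (p := (2 : ℂ)⁻¹ • (1 + (B.Z j : Op (Fin n))))
    (List.mem_ofFn.2 ⟨j, rfl⟩) ?_ (List.forall_mem_ofFn_iff.2 (B.commute_Z_smul_one_add_Z j))
  rw [mul_smul_comm, mul_add, mul_one, Z_mul_self, add_comm]

lemma zeroProj_mul_Z (j : Fin k) : B.zeroProj * (B.Z j : Op (Fin n)) = B.zeroProj := by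
  have hcomm : Commute (B.Z j : Op (Fin n)) B.zeroProj :=
    Commute.list_prod_right _ _ (List.forall_mem_ofFn_iff.2 (B.commute_Z_smul_one_add_Z j))
  rw [← hcomm.eq, Z_mul_zeroProj]

lemma zeroProj_mul_self : B.zeroProj * B.zeroProj = B.zeroProj :=
  mul_list_prod_eq_self <| List.forall_mem_ofFn_iff.2 fun j => by
    rw [mul_smul_comm, mul_add, mul_one, zeroProj_mul_Z, ← two_smul ℂ B.zeroProj,
      inv_smul_smul₀ two_ne_zero]

/-- For `x ≠ y` the two sides of the product are eigenvectors of some `Z j` with different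
eigenvalues. -/
lemma zeroProj_mul_xPow_mul_xPow_mul_zeroProj (x y : Fin k → Fin 2) :
    B.zeroProj * (B.xPow x)ᴴ * (B.xPow y * B.zeroProj) = if x = y then B.zeroProj else 0 := by
  split_ifs with h
  · rw [h, mul_assoc, ← mul_assoc (B.xPow y)ᴴ, xPow_conjTranspose_mul_self, one_mul,
      zeroProj_mul_self]
  · obtain ⟨j, hj⟩ := Function.ne_iff.1 h
    have hx : B.zeroProj * (B.xPow x)ᴴ * (B.Z j : Op (Fin n)) =
        (-1 : ℂ) ^ (x j : ℕ) • (B.zeroProj * (B.xPow x)ᴴ) := by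
      rw [mul_assoc, xPow_conjTranspose_mul_Z, mul_smul_comm, ← mul_assoc, zeroProj_mul_Z]
    have hy : (B.Z j : Op (Fin n)) * (B.xPow y * B.zeroProj) =
        (-1 : ℂ) ^ (y j : ℕ) • (B.xPow y * B.zeroProj) := by
      rw [← mul_assoc, Z_mul_xPow, smul_mul_assoc, mul_assoc, Z_mul_zeroProj]
    have hxy := mul_assoc (B.zeroProj * (B.xPow x)ᴴ) (B.Z j : Op (Fin n)) (B.xPow y * B.zeroProj)
    rw [hx, hy, smul_mul_assoc, mul_smul_comm, ← sub_eq_zero, ← sub_smul] at hxy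
    refine (smul_eq_zero.1 hxy).resolve_left (sub_ne_zero.2 fun hpow => hj ?_)
    generalize x j = s at hpow ⊢
    generalize y j = t at hpow ⊢
    fin_cases s <;> fin_cases t <;> first | rfl | norm_num at hpow

lemma logical_matrixUnits_mul (x y z w : Fin k → Fin 2) :
    B.xPow x * B.zeroProj * (B.xPow y)ᴴ * (B.xPow z * B.zeroProj * (B.xPow w)ᴴ) =
      if y = z then B.xPow x * B.zeroProj * (B.xPow w)ᴴ else 0 := by
  calc B.xPow x * B.zeroProj * (B.xPow y)ᴴ * (B.xPow z * B.zeroProj * (B.xPow w)ᴴ)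
      = B.xPow x * (B.zeroProj * (B.xPow y)ᴴ * (B.xPow z * B.zeroProj)) * (B.xPow w)ᴴ := by
        simp only [mul_assoc]
    _ = if y = z then B.xPow x * B.zeroProj * (B.xPow w)ᴴ else 0 := by
        rw [zeroProj_mul_xPow_mul_xPow_mul_zeroProj, mul_ite, ite_mul, mul_zero, zero_mul]

/-- `logical` as a homomorphism of algebras. -/
noncomputable def logicalHom : Op (Fin k) →ₙₐ[ℂ] Op (Fin n) :=
  ofMatrixUnits _ B.logical_matrixUnits_mul

end SymplecticBasis

/-- The outer codes `Q_L ∘ ⋯ ∘ Q_2`. -/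
abbrev tail {L : ℕ} (C : Fin (L + 1) → BasedCode) : Fin L → BasedCode := fun i => C i.succ

/-- The substitution of the logical Pauli operators of `Q_1` for the Pauli operators on its
logical qubits, in each block. -/
noncomputable def innerHom {L : ℕ} (C : Fin (L + 1) → BasedCode) :
    Op (Fin (C 0).k × Qubit (tail C) 0) →ₙₐ[ℂ] Op (Fin (C 0).n × Qubit (tail C) 0) :=
  onBlocks (Equiv.prodComm (Qubit (tail C) 0) (Fin (C 0).k))
    (Equiv.prodComm (Qubit (tail C) 0) (Fin (C 0).n)) (C 0).basis.logicalHom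

/-- `lift` as a homomorphism of algebras. -/
noncomputable def liftHom : {L : ℕ} → (C : Fin L → BasedCode) → (l : ℕ) →
    Op (Qubit C l) →ₙₐ[ℂ] Op (Qubit C 0)
  | 0, C, _ => NonUnitalAlgHom.id ℂ (Op (Qubit C 0))
  | _ + 1, C, 0 => NonUnitalAlgHom.id ℂ (Op (Qubit C 0))
  | _ + 1, C, l + 1 => (innerHom C).comp
      (onBlocks (Equiv.refl (Fin (C 0).k × Qubit (tail C) l))
        (Equiv.refl (Fin (C 0).k × Qubit (tail C) 0)) (liftHom (tail C) l))

lemma coe_innerHom {L : ℕ} (C : Fin (L + 1) → BasedCode) :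
    ⇑(innerHom C) = onCols (C 0).basis.logical :=
  (onCols_eq_onBlocks _).symm

lemma coe_liftHom : ∀ {L : ℕ} (C : Fin L → BasedCode) (l : ℕ), ⇑(liftHom C l) = lift C l
  | 0, _, _ => rfl
  | _ + 1, _, 0 => rfl
  | _ + 1, C, l + 1 => by
    funext U
    have h := onRows_eq_onBlocks (R := Fin (C 0).k) (liftHom (tail C) l)
    rw [coe_liftHom] at h
    exact (congrFun (coe_innerHom C) _).trans (congrArg (onCols _) (congrFun h U).symm)

lemma lift_zero {L : ℕ} (C : Fin L → BasedCode) (U : Op (Qubit C 0)) : lift C 0 U = U := by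
  cases L <;> rfl

section Concatenation

variable {L : ℕ} (C : Fin (L + 1) → BasedCode)

lemma lift_succ_tensor (l : ℕ)
    (F : Fin (C 0).k × Qubit (tail C) l → Matrix (Fin 2) (Fin 2) ℂ) :
    lift C (l + 1) (tensor (ι := Qubit C (l + 1)) F) =
      innerHom C (blockTensor (Equiv.refl _) fun j =>
        lift (tail C) l (tensor fun q => F (j, q))) := by
  rw [← coe_liftHom, ← coe_liftHom]
  exact congrArg (innerHom C)
    ((congrArg _ (tensor_eq_blockTensor (Equiv.refl _) F)).trans (onBlocks_blockTensor _ _ _ _))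

lemma codeSpace_le_outer : codeSpace C ≤
    fixedSpace (innerHom C '' ⋃ j, atBlockHom (Equiv.refl _) j '' stabGens (tail C)) := by
  refine fixedSpace_anti (Set.image_subset_iff.2 (Set.iUnion_subset fun j => ?_))
  rintro _ ⟨g, hg, rfl⟩
  exact Or.inr ⟨j, g, hg, congrFun (coe_innerHom C) (atRow j g)⟩

lemma codeSpace_le_inner : codeSpace C ≤
    fixedSpace (⋃ r, atBlockHom (Equiv.prodComm (Qubit (tail C) 0) (Fin (C 0).n)) r ''
      (C 0).code.ops) := by
  refine fixedSpace_anti (Set.iUnion_subset fun r => ?_)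
  rintro _ ⟨g, hg, rfl⟩
  exact Or.inl ⟨r, g, hg, rfl⟩

lemma gateEq_succ_succ {l m : ℕ} (F : Fin (C 0).k × Qubit (tail C) l → Matrix (Fin 2) (Fin 2) ℂ)
    (G : Fin (C 0).k × Qubit (tail C) m → Matrix (Fin 2) (Fin 2) ℂ)
    (h : ∀ j, GateEq (tail C) (tensor fun q => F (j, q)) (tensor fun q => G (j, q))) :
    GateEq C (tensor (ι := Qubit C (l + 1)) F) (tensor (ι := Qubit C (m + 1)) G) := by
  rw [GateEq, lift_succ_tensor, lift_succ_tensor]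
  exact ((eqOn_blockTensor (Equiv.refl _) h).map (innerHom C)).mono (codeSpace_le_outer C)

lemma lift_one_tensor (F : Fin (C 0).k × Qubit (tail C) 0 → Matrix (Fin 2) (Fin 2) ℂ) :
    lift C 1 (tensor (ι := Qubit C 1) F) =
      blockTensor (Equiv.prodComm (Qubit (tail C) 0) (Fin (C 0).n)) fun r =>
        (C 0).basis.logical (tensor fun j => F (j, r)) := by
  have regroup := (tensor_eq_blockTensor (Equiv.refl _) F).symm.trans
    (tensor_eq_blockTensor (Equiv.prodComm (Qubit (tail C) 0) (Fin (C 0).k)) F)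
  simp only [lift_succ_tensor, lift_zero]
  exact (congrArg (innerHom C) regroup).trans (onBlocks_blockTensor _ _ _ _)

lemma gateEq_one_zero (F : Fin (C 0).k × Qubit (tail C) 0 → Matrix (Fin 2) (Fin 2) ℂ)
    (G : Fin (C 0).n × Qubit (tail C) 0 → Matrix (Fin 2) (Fin 2) ℂ)
    (h : ∀ r, EqOn (C 0).code.codeSpace ((C 0).basis.logical (tensor fun j => F (j, r)))
      (tensor fun i => G (i, r))) :
    GateEq C (tensor (ι := Qubit C 1) F) (tensor (ι := Qubit C 0) G) := by
  have hG := tensor_eq_blockTensor (Equiv.prodComm (Qubit (tail C) 0) (Fin (C 0).n)) G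
  rw [GateEq, lift_one_tensor, lift_zero]
  exact hG ▸ (eqOn_blockTensor _ h).mono (codeSpace_le_inner C)

end Concatenation

/-- Every tensor product of logical gates from the family `g` is implemented by a tensor product of
physical gates from the same family. Compatibility of a symplectic basis is this property of the
one-element family `H` and of the family `S, S⁻¹`. -/
def BasedCode.IsTransversalFor (Q : BasedCode) {Γ : Type*} (g : Γ → Matrix (Fin 2) (Fin 2) ℂ) :
    Prop :=
  ∀ a : Fin Q.k → Γ, ∃ b : Fin Q.n → Γ, EqOn Q.code.codeSpace
    (Q.basis.logical (tensor fun j => g (a j))) (tensor fun i => g (b i))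

theorem exists_gateEq_tensor {Γ : Type*} {g : Γ → Matrix (Fin 2) (Fin 2) ℂ} {L : ℕ}
    {C : Fin L → BasedCode} (hg : ∀ l, (C l).IsTransversalFor g) (a : Qubit C L → Γ) {m : ℕ}
    (hm : m ≤ L) :
    ∃ b : Qubit C m → Γ, GateEq C (tensor fun q => g (a q)) (tensor fun q => g (b q)) := by
  induction L generalizing m with
  | zero =>
    obtain rfl : m = 0 := Nat.le_zero.1 hm
    exact ⟨a, EqOn.refl _ _⟩
  | succ L ih =>
    have outer (m : ℕ) (hm : m ≤ L) : ∃ b : Qubit C (m + 1) → Γ,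
        GateEq C (tensor fun q => g (a q)) (tensor fun q => g (b q)) := by
      choose b hb using fun j : Fin (C 0).k =>
        ih (C := tail C) (fun l => hg l.succ) (fun q => a (j, q)) hm
      exact ⟨fun q => b q.1 q.2,
        gateEq_succ_succ C (fun q => g (a q)) (fun q => g (b q.1 q.2)) hb⟩
    cases m with
    | succ m => exact outer m (Nat.le_of_succ_le_succ hm)
    | zero =>
      obtain ⟨b, hb⟩ := outer 0 (Nat.zero_le L)
      choose d hd using fun r : Qubit (tail C) 0 => hg 0 fun j => b (j, r)
      exact ⟨fun q => d q.2 q.1, hb.trans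
        (gateEq_one_zero C (fun q => g (b q)) (fun q => g (d q.2 q.1)) hd)⟩

lemma isTransversalAt_tensor {Γ : Type*} {g : Γ → Matrix (Fin 2) (Fin 2) ℂ}
    (hU : ∀ c, g c ∈ Matrix.unitaryGroup (Fin 2) ℂ) {L : ℕ} {C : Fin L → BasedCode}
    (hg : ∀ l, (C l).IsTransversalFor g) (a : Qubit C L → Γ) {m : ℕ} (hm : m ≤ L) :
    IsTransversalAt C (tensor fun q => g (a q)) m :=
  let ⟨b, hb⟩ := exists_gateEq_tensor hg a hm
  ⟨fun q => ⟨g (b q), hU (b q)⟩, hb⟩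

lemma hadamard_mem_unitaryGroup : hadamard ∈ Matrix.unitaryGroup (Fin 2) ℂ := by
  have h : ((Real.sqrt 2 : ℝ) : ℂ)⁻¹ * ((Real.sqrt 2 : ℝ) : ℂ)⁻¹ = 2⁻¹ := by
    rw [← mul_inv, ← Complex.ofReal_mul, Real.mul_self_sqrt zero_le_two, Complex.ofReal_ofNat]
  rw [Matrix.mem_unitaryGroup_iff, Matrix.star_eq_conjTranspose]
  ext i j
  fin_cases i <;> fin_cases j <;>
    simp [hadamard, Matrix.mul_apply, Fin.sum_univ_two, h] <;> norm_num

lemma phase_mem_unitaryGroup : phase ∈ Matrix.unitaryGroup (Fin 2) ℂ := by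
  rw [Matrix.mem_unitaryGroup_iff, Matrix.star_eq_conjTranspose]
  ext i j
  fin_cases i <;> fin_cases j <;> simp [phase, Matrix.mul_apply, Fin.sum_univ_two]

lemma phase_zpow_mem_unitaryGroup (a : ℤˣ) :
    phase ^ (a : ℤ) ∈ Matrix.unitaryGroup (Fin 2) ℂ := by
  rcases Int.units_eq_one_or a with rfl | rfl
  · simpa using phase_mem_unitaryGroup
  · have h : phase⁻¹ = star phase :=
      Matrix.inv_eq_left_inv (Matrix.mem_unitaryGroup_iff'.1 phase_mem_unitaryGroup)
    simpa [h] using Unitary.star_mem phase_mem_unitaryGroup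

end QCode

theorem corollary2_general {L : ℕ} (C : Fin L → QCode.BasedCode)
    (hcompat : ∀ l, (C l).basis.IsCompatible) :
    ((∀ m ≤ L, QCode.IsTransversalAt C
        (QCode.tensor fun _ : QCode.Qubit C L => QCode.hadamard) m) ∧
      QCode.GateEq C (QCode.tensor fun _ : QCode.Qubit C L => QCode.hadamard)
        (QCode.tensor fun _ : QCode.Qubit C 0 => QCode.hadamard)) ∧
    ∀ a : QCode.Qubit C L → ℤˣ,
      (∀ m ≤ L, QCode.IsTransversalAt C
        (QCode.tensor fun j : QCode.Qubit C L => QCode.phase ^ ((a j : ℤˣ) : ℤ)) m) ∧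
      ∃ b : QCode.Qubit C 0 → ℤˣ,
        QCode.GateEq C (QCode.tensor fun j : QCode.Qubit C L => QCode.phase ^ ((a j : ℤˣ) : ℤ))
          (QCode.tensor fun i : QCode.Qubit C 0 => QCode.phase ^ ((b i : ℤˣ) : ℤ)) := by
  have hH (l : Fin L) : (C l).IsTransversalFor fun _ : Unit => QCode.hadamard :=
    fun _ => ⟨fun _ => (), (hcompat l).hadamard⟩
  have hS (l : Fin L) : (C l).IsTransversalFor fun a : ℤˣ => QCode.phase ^ (a : ℤ) :=
    (hcompat l).phase
  refine ⟨⟨fun m hm => ?_, ?_⟩, fun a => ⟨fun m hm => ?_, ?_⟩⟩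
  · exact QCode.isTransversalAt_tensor (fun _ => QCode.hadamard_mem_unitaryGroup) hH
      (fun _ => ()) hm
  · exact (QCode.exists_gateEq_tensor hH (fun _ => ()) (Nat.zero_le L)).choose_spec
  · exact QCode.isTransversalAt_tensor QCode.phase_zpow_mem_unitaryGroup hS a hm
  · exact QCode.exists_gateEq_tensor hS a (Nat.zero_le L)

theorem corollary2 {L : ℕ} (C : Fin L → QCode.BasedCode)
    (hk : ∀ l, 1 ≤ (C l).k)
    (hcss : ∀ l, (C l).code.IsSelfDualCSS)
    (hcompat : ∀ l, (C l).basis.IsCompatible) :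
    ((∀ m ≤ L, QCode.IsTransversalAt C
        (QCode.tensor fun _ : QCode.Qubit C L => QCode.hadamard) m) ∧
      QCode.GateEq C (QCode.tensor fun _ : QCode.Qubit C L => QCode.hadamard)
        (QCode.tensor fun _ : QCode.Qubit C 0 => QCode.hadamard)) ∧
    ∀ a : QCode.Qubit C L → ℤˣ,
      (∀ m ≤ L, QCode.IsTransversalAt C
        (QCode.tensor fun j : QCode.Qubit C L => QCode.phase ^ ((a j : ℤˣ) : ℤ)) m) ∧
      ∃ b : QCode.Qubit C 0 → ℤˣ,
        QCode.GateEq C (QCode.tensor fun j : QCode.Qubit C L => QCode.phase ^ ((a j : ℤˣ) : ℤ))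
          (QCode.tensor fun i : QCode.Qubit C 0 => QCode.phase ^ ((b i : ℤˣ) : ℤ)) :=
  corollary2_general C hcompat
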